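/- For each $\ell\in\mathbb N$ let $\mathbf r(\ell)=(r_1(\ell)\ge r_2(\ell)\ge\cdots\ge r_{m(\ell)}(\ell))$ and $\mathbf c(\ell)=(c_1(\ell)\ge c_2(\ell)\ge\cdots\ge c_{n(\ell)}(\ell))$ be non-increasing vectors of non-negative integers with $\sum_{i=1}^{m(\ell)}r_i(\ell)=\sum_{j=1}^{n(\ell)}c_j(\ell)=N(\ell)$, where $N(\ell)\to\infty$ as $\ell\to\infty$ (for instance $N(\ell)=\ell$). Put $r_i(\ell)=0$ for $i>m(\ell)$ and $c_j(\ell)=0$ for $j>n(\ell)$, and write $S=(\mathbf r(\ell),\mathbf c(\ell),N(\ell))_\ell$. A subsequence of $S$ is a sequence $S'=(\mathbf r'(\ell),\mathbf c'(\ell),N'(\ell))_{\ell}$ with $\mathbf r'(\ell)=\mathbf r(k_{\ell})$, $\mathbf c'(\ell)=\mathbf c(k_{\ell})$, $N'(\ell)=N(k_{\ell})$ for some strictly increasing sequence of indices $(k_\ell)_\ell$. For any such sequence of tuples define $$\kappa(S)=\min\{i\ge 1:\ r_i(\ell)=o(N(\ell))\text{ as }\ell\to\infty\}\in\{1,2,\dots\}\cup\{\infty\},$$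 with $\kappa(S)=\infty$ if no such $i$ exists; in that case the sum $\sum_{i=\kappa(S)}^\infty r_i(\ell)/N(\ell)$ is understood to be $0$. Let $\Omega_{\mathbf r,\mathbf c}$ be the set of matrices with entries in $\{0,1\}$, row sums $\mathbf r$ and column sums $\mathbf c$. Let $T=T(\ell)$ be the random table produced by the configuration model: take $r_i(\ell)$ labelled type-1 tokens for each row $i$ and $c_j(\ell)$ labelled type-2 tokens for each column $j$, choose a uniformly random perfect matching between type-1 and type-2 tokens, and let $T_{i,j}$ be the number of type-1 tokens of row $i$ matched to type-2 tokens of column $j$. Assume that, as $\ell\to\infty$, $$\sum_{i=1}^{m(\ell)}\sum_{j=1}^{n(\ell)}r_i(\ell)(r_i(\ell)-1)c_j(\ell)(c_j(\ell)-1)=O(N(\ell)^2)\qquad\text{and}\qquad r_1(\ell)=\Omega(N(\ell)).$$ Then $\mathbf P(T\in\Omega_{\mathbf r,\mathbf c})=\Omega(1)$ as $\ell\to\infty$ if and only if, for every subsequence $S'$ of $S$, $$\limsup_{\ell\to\infty}\sum_{i=\kappa(S')}^\infty\frac{r'_i(\ell)}{N'(\ell)}>0\qquad\text{or}\qquad\limsup_{\ell\to\infty}c'_1(\ell)<\kappa(S').$$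 -/

import Mathlib

open Filter Asymptotics
open scoped ENNReal

namespace ConfigModel

/-! ### Tables and the configuration model for given row and column sums -/

/-- The tokens attached to a vector of sums `v`: `v i` labelled tokens for every index `i`. -/
abbrev Token {m : ℕ} (v : Fin m → ℕ) : Type := Σ i : Fin m, Fin (v i)

/-- The table of a perfect matching `e` between the type-1 tokens (rows) and the type-2 tokens
(columns): the entry `(i, j)` is the number of tokens of row `i` matched to a token of
column `j`. -/
def table {m n : ℕ} {r : Fin m → ℕ} {c : Fin n → ℕ} (e : Token r ≃ Token c) :
    Matrix (Fin m) (Fin n) ℕ :=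
  Matrix.of fun i j => (Finset.univ.filter fun k : Fin (r i) => (e ⟨i, k⟩).1 = j).card

/-- The set of binary contingency tables with row sums `r` and column sums `c`. -/
def binaryTables {m n : ℕ} (r : Fin m → ℕ) (c : Fin n → ℕ) : Set (Matrix (Fin m) (Fin n) ℕ) :=
  {A | (∀ i j, A i j = 0 ∨ A i j = 1) ∧ (∀ i, ∑ j, A i j = r i) ∧ (∀ j, ∑ i, A i j = c j)}

theorem nonempty_matching {m n : ℕ} {r : Fin m → ℕ} {c : Fin n → ℕ}
    (h : ∑ i, r i = ∑ j, c j) : Nonempty (Token r ≃ Token c) :=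
  ⟨Fintype.equivOfCardEq (by simpa [Token] using h)⟩

/-- The law of the random table produced by the configuration model: the table of a uniformly
random perfect matching between type-1 and type-2 tokens. -/
noncomputable def randomTable {m n : ℕ} (r : Fin m → ℕ) (c : Fin n → ℕ)
    (h : ∑ i, r i = ∑ j, c j) : PMF (Matrix (Fin m) (Fin n) ℕ) :=
  haveI := nonempty_matching h
  (PMF.uniformOfFintype (Token r ≃ Token c)).map table

/-! ### Input sequences -/

/-- A sequence of tuples `(r(ℓ), c(ℓ), N(ℓ))` of non-increasing vectors of non-negative integers
`r(ℓ)` (of length `m ℓ`) and `c(ℓ)` (of length `n ℓ`), both with sum `N ℓ`. The vectors are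
extended by zeros to infinite ones. Indices start at `0`, so that `r ℓ i` is the `(i+1)`-st row
sum, the largest row sum is `r ℓ 0` and the largest column sum is `c ℓ 0`. -/
structure InputSequence where
  m : ℕ → ℕ
  n : ℕ → ℕ
  N : ℕ → ℕ
  r : ℕ → ℕ → ℕ
  c : ℕ → ℕ → ℕ
  r_antitone : ∀ ℓ, Antitone (r ℓ)
  c_antitone : ∀ ℓ, Antitone (c ℓ)
  r_eq_zero : ∀ ℓ i, m ℓ ≤ i → r ℓ i = 0
  c_eq_zero : ∀ ℓ j, n ℓ ≤ j → c ℓ j = 0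
  sum_r : ∀ ℓ, ∑ i : Fin (m ℓ), r ℓ i = N ℓ
  sum_c : ∀ ℓ, ∑ j : Fin (n ℓ), c ℓ j = N ℓ

namespace InputSequence

/-- The subsequence of `S` along the strictly increasing indices `k 0 < k 1 < ⋯`. -/
def subseq (S : InputSequence) (k : ℕ → ℕ) : InputSequence where
  m ℓ := S.m (k ℓ)
  n ℓ := S.n (k ℓ)
  N ℓ := S.N (k ℓ)
  r ℓ := S.r (k ℓ)
  c ℓ := S.c (k ℓ)
  r_antitone ℓ := S.r_antitone (k ℓ)
  c_antitone ℓ := S.c_antitone (k ℓ)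
  r_eq_zero ℓ := S.r_eq_zero (k ℓ)
  c_eq_zero ℓ := S.c_eq_zero (k ℓ)
  sum_r ℓ := S.sum_r (k ℓ)
  sum_c ℓ := S.sum_c (k ℓ)

/-- `S'` is a subsequence of `S`. -/
def IsSubseq (S' S : InputSequence) : Prop :=
  ∃ k : ℕ → ℕ, StrictMono k ∧ S' = S.subseq k

/-- The probability that the table produced by the configuration model with row sums `r(ℓ)` and
column sums `c(ℓ)` is a binary contingency table. -/
noncomputable def probBinary (S : InputSequence) (ℓ : ℕ) : ℝ :=
  ((randomTable (fun i : Fin (S.m ℓ) => S.r ℓ i) (fun j : Fin (S.n ℓ) => S.c ℓ j)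
      ((S.sum_r ℓ).trans (S.sum_c ℓ).symm)).toOuterMeasure
    (binaryTables (fun i : Fin (S.m ℓ) => S.r ℓ i) (fun j : Fin (S.n ℓ) => S.c ℓ j))).toReal

/-- `κ(S)`, the first row (counted from `1`) whose sum is `o(N)`; it is `∞` if there is none. -/
noncomputable def kappa (S : InputSequence) : ℕ∞ :=
  sInf {k : ℕ∞ | ∃ i : ℕ, k = ((i + 1 : ℕ) : ℕ∞) ∧
    (fun ℓ => (S.r ℓ i : ℝ)) =o[atTop] (fun ℓ => (S.N ℓ : ℝ))}

open Classical in
/-- The sum of the row sums over all rows with (1-based) number at least `κ(S)`; it is `0` if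
`κ(S) = ∞`. -/
noncomputable def tailSum (S : InputSequence) (ℓ : ℕ) : ℕ :=
  ∑ i ∈ (Finset.range (S.m ℓ)).filter (fun i : ℕ => S.kappa ≤ ((i + 1 : ℕ) : ℕ∞)), S.r ℓ i

end InputSequence

end ConfigModel

/-! Since the largest row has order `N`, the second moment condition forces `∑ c_j (c_j - 1) =
O(1)`. So only boundedly many tokens lie in columns with at least two tokens, and the table is
binary exactly when tokens sharing a column go to distinct rows.

Upper bound: if a column has at least `κ` tokens, a binary table must send one of them outside the
first `κ - 1` rows. The union bound gives probability at most `κ` times the tail proportion, which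
tends to `0` when the tail is negligible (`toReal_randomTable_binaryTables_le`).

Lower bound: the at most `C` critical tokens are placed one after another, each avoiding conflicts
inside a prescribed set with conditional probability at least `θ`, so the total is at least `θ ^ C`
(`pow_le_toReal_randomTable_binaryTables`). The prescribed set is the tail when it has mass of order
`N`, its rows being individually `o(N)`. When `c_1 < κ`, the `a`-th token of each column is sent to
the `a`-th row, which has order `N`.

Limsups only give bounds for infinitely many `ℓ`; quantifying over subsequences closes this gap. -/

namespace ConfigModel

/-! ### Counting matchings by switchings -/

section Counting

variable {X Y β : Type*} [Fintype X] [Fintype Y] [DecidableEq X] [DecidableEq Y] [DecidableEq β]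

/-- A prescribed element of `Y` is matched into `A` with probability at most `|A| / |Y|`. -/
theorem card_mul_card_matched_into_le (A : Finset X) (y : Y) :
    Fintype.card Y * (Finset.univ.filter fun e : X ≃ Y => e.symm y ∈ A).card ≤
      A.card * Fintype.card (X ≃ Y) := by
  have key : ((Finset.univ : Finset Y) ×ˢ
      (Finset.univ.filter fun e : X ≃ Y => e.symm y ∈ A)).card ≤
      (A ×ˢ (Finset.univ : Finset (X ≃ Y))).card := by
    -- The new matching sends the recorded `e.symm y` to `z`, so `z`, and then `e`, can be
    -- recovered.
    refine Finset.card_le_card_of_injOn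
      (fun p => (p.2.symm y, p.2.trans (Equiv.swap y p.1))) ?_ ?_
    · rintro ⟨z, e⟩ h
      simpa using h
    · rintro ⟨z, e⟩ - ⟨z', e'⟩ - h
      simp only [Prod.mk.injEq] at h
      obtain ⟨h1, h2⟩ := h
      have hz : z = z' := by
        have h3 := congrArg (fun f : X ≃ Y => f (e.symm y)) h2
        simp only [Equiv.trans_apply, Equiv.apply_symm_apply, Equiv.swap_apply_left] at h3
        rw [h1] at h3
        simpa using h3
      subst hz
      have : e = e' := by
        ext x
        have h3 := congrArg (fun f : X ≃ Y => f x) h2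
        simpa using h3
      rw [this]
  simpa [Finset.card_product] using key

/-- The matchings that send every `y ∈ D` into `A y`, and distinct elements of `D` to elements of
distinct colours. -/
def colourfulMatchings (D : Finset Y) (A : Y → Finset X) (g : X → β) : Finset (X ≃ Y) :=
  Finset.univ.filter fun e => ∀ y ∈ D, e.symm y ∈ A y ∧
    ∀ y' ∈ D, g (e.symm y) = g (e.symm y') → y = y'

theorem mem_colourfulMatchings {D : Finset Y} {A : Y → Finset X} {g : X → β} {e : X ≃ Y} :
    e ∈ colourfulMatchings D A g ↔ ∀ y ∈ D, e.symm y ∈ A y ∧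
      ∀ y' ∈ D, g (e.symm y) = g (e.symm y') → y = y' := by
  simp [colourfulMatchings]

/-- Switching: in a matching good for `D`, the partner of `y` is swapped for any `x ∈ A y` of a
colour not yet used. This leaves the partners of `D` untouched, and the old matching is recovered
from the new one and `e x`, which has `|Y|` possible values. The used colours exclude at most `|D| *
s` elements of `A y`. -/
theorem mul_card_colourfulMatchings_le_insert {D : Finset Y} {A : Y → Finset X} {g : X → β}
    {y : Y} (hy : y ∉ D) {t s : ℕ}
    (hs : ∀ w ∈ D, ∀ x ∈ A w, (Finset.univ.filter fun x' => g x = g x').card ≤ s)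
    (ht : t + D.card * s ≤ (A y).card) :
    t * (colourfulMatchings D A g).card ≤
      Fintype.card Y * (colourfulMatchings (insert y D) A g).card := by
  let Z : (X ≃ Y) → Finset X := fun e =>
    A y \ D.biUnion fun w => Finset.univ.filter fun x' => g (e.symm w) = g x'
  have hZ : ∀ e ∈ colourfulMatchings D A g, t ≤ (Z e).card := by
    intro e he
    have he' : ∀ w ∈ D, e.symm w ∈ A w := fun w hw => ((Finset.mem_filter.1 he).2 w hw).1
    have h1 : (D.biUnion fun w => Finset.univ.filter fun x' => g (e.symm w) = g x').card ≤
        D.card * s := Finset.card_biUnion_le_card_mul _ _ _ fun w hw => hs w hw _ (he' w hw)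
    have h2 := Finset.le_card_sdiff
      (D.biUnion fun w => Finset.univ.filter fun x' => g (e.symm w) = g x') (A y)
    change t ≤ (A y \ _).card
    omega
  have h1 : t * (colourfulMatchings D A g).card ≤
      ((colourfulMatchings D A g).sigma Z).card := by
    rw [Finset.card_sigma, mul_comm]
    simpa using Finset.card_nsmul_le_sum _ _ _ hZ
  refine h1.trans ?_
  rw [← Finset.card_univ, ← Finset.card_product]
  refine Finset.card_le_card_of_injOn
    (fun p => (p.1 p.2, p.1.trans (Equiv.swap y (p.1 p.2)))) ?_ ?_
  · rintro ⟨e, x⟩ h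
    simp only [Finset.coe_sigma, Set.mem_sigma_iff, Finset.mem_coe] at h
    obtain ⟨he, hx⟩ := h
    have he := (Finset.mem_filter.1 he).2
    simp only [Z, Finset.mem_sdiff, Finset.mem_biUnion, Finset.mem_filter, Finset.mem_univ,
      true_and, not_exists, not_and] at hx
    obtain ⟨hxA, hxD⟩ := hx
    have hyy : (e.trans (Equiv.swap y (e x))).symm y = x := by simp
    have hD : ∀ w ∈ D, (e.trans (Equiv.swap y (e x))).symm w = e.symm w := by
      intro w hw
      have h1 : w ≠ y := fun h => hy (h ▸ hw)
      have h2 : w ≠ e x := by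
        rintro rfl
        exact hxD _ hw (by simp)
      simp [Equiv.swap_apply_of_ne_of_ne h1 h2]
    simp only [Finset.coe_product, Set.mem_prod, Finset.mem_coe, Finset.mem_univ, true_and]
    refine Finset.mem_filter.2 ⟨Finset.mem_univ _, fun w hwD => ?_⟩
    rcases Finset.mem_insert.1 hwD with rfl | hw
    · refine ⟨by rw [hyy]; exact hxA, fun w' hw' h => ?_⟩
      rcases Finset.mem_insert.1 hw' with rfl | hw'
      · rfl
      · rw [hyy, hD _ hw'] at h
        exact absurd h.symm (hxD _ hw')
    · refine ⟨by rw [hD _ hw]; exact (he w hw).1, fun w' hw' h => ?_⟩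
      rcases Finset.mem_insert.1 hw' with rfl | hw'
      · rw [hyy, hD _ hw] at h
        exact absurd h (hxD _ hw)
      · rw [hD _ hw, hD _ hw'] at h
        exact (he w hw).2 w' hw' h
  · rintro ⟨e, x⟩ - ⟨e', x'⟩ - h
    simp only [Prod.mk.injEq] at h
    obtain ⟨h1, h2⟩ := h
    have : e = e' := by
      ext w
      have h3 := congrArg (fun f : X ≃ Y => f w) h2
      rw [h1] at h3
      simpa using h3
    subst this
    simpa using h1

theorem pow_mul_card_le_card_colourfulMatchings {D : Finset Y} {A : Y → Finset X} {g : X → β}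
    {t s : ℕ} (hs : ∀ w ∈ D, ∀ x ∈ A w, (Finset.univ.filter fun x' => g x = g x').card ≤ s)
    (ht : ∀ y ∈ D, t + D.card * s ≤ (A y).card) :
    t ^ D.card * Fintype.card (X ≃ Y) ≤
      Fintype.card Y ^ D.card * (colourfulMatchings D A g).card := by
  induction D using Finset.induction_on with
  | empty => simp [colourfulMatchings]
  | insert y D hy ih =>
    have hc := Finset.card_insert_of_notMem hy
    have ih := ih (fun w hw => hs w (Finset.mem_insert_of_mem hw)) fun w hw => by
      have := ht w (Finset.mem_insert_of_mem hw)
      rw [hc] at this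
      nlinarith
    have h1 := mul_card_colourfulMatchings_le_insert hy (t := t) (g := g)
      (fun w hw => hs w (Finset.mem_insert_of_mem hw)) (by
        have := ht y (Finset.mem_insert_self _ _)
        rw [hc] at this
        nlinarith)
    rw [hc, pow_succ, pow_succ]
    calc t ^ D.card * t * Fintype.card (X ≃ Y)
        = t * (t ^ D.card * Fintype.card (X ≃ Y)) := by ring
      _ ≤ t * (Fintype.card Y ^ D.card * (colourfulMatchings D A g).card) := by gcongr
      _ = Fintype.card Y ^ D.card * (t * (colourfulMatchings D A g).card) := by ring
      _ ≤ Fintype.card Y ^ D.card *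
          (Fintype.card Y * (colourfulMatchings (insert y D) A g).card) := by gcongr
      _ = _ := by ring

end Counting

/-! ### Probability bounds for one table -/

section Table

variable {m n : ℕ} {r : Fin m → ℕ} {c : Fin n → ℕ}

theorem card_filter_token_fst (p : Fin m → Prop) [DecidablePred p] :
    (Finset.univ.filter fun x : Token r => p x.1).card = ∑ i with p i, r i := by
  have h : (Finset.univ.filter fun x : Token r => p x.1) =
      (Finset.univ.filter p).sigma fun _ => Finset.univ := by
    ext x
    simp
  rw [h, Finset.card_sigma]
  simp

theorem sum_table_row (e : Token r ≃ Token c) (i : Fin m) : ∑ j, table e i j = r i := by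
  simp only [table, Matrix.of_apply]
  rw [← Finset.card_eq_sum_card_fiberwise (fun _ _ => Finset.mem_coe.2 (Finset.mem_univ _))]
  simp

theorem sum_table_col (e : Token r ≃ Token c) (j : Fin n) : ∑ i, table e i j = c j := by
  have h1 : ∑ i, table e i j = (Finset.univ.filter fun x : Token r => (e x).1 = j).card := by
    have h : (Finset.univ.filter fun x : Token r => (e x).1 = j) = Finset.univ.sigma
        fun i => Finset.univ.filter fun k : Fin (r i) => (e ⟨i, k⟩).1 = j := by
      ext x
      simp
    rw [h, Finset.card_sigma]
    rfl
  have h2 : (Finset.univ.filter fun x : Token r => (e x).1 = j).card =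
      (Finset.univ.filter fun y : Token c => y.1 = j).card :=
    Finset.card_equiv e (by simp)
  have h3 : (Finset.univ.filter fun y : Token c => y.1 = j).card = c j := by
    simp [card_filter_token_fst (fun j' => j' = j), Finset.sum_filter]
  omega

/-- The table of a matching is binary if and only if the tokens of each column are matched to
tokens of distinct rows. -/
theorem table_mem_binaryTables_iff (e : Token r ≃ Token c) :
    table e ∈ binaryTables r c ↔
      ∀ y y' : Token c, y.1 = y'.1 → (e.symm y).1 = (e.symm y').1 → y = y' := by
  constructor
  · rintro ⟨h, -, -⟩ y y' hc hr
    obtain ⟨⟨i, a⟩, rfl⟩ := e.surjective y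
    obtain ⟨⟨i', a'⟩, rfl⟩ := e.surjective y'
    simp only [Equiv.symm_apply_apply] at hr
    subst hr
    have h1 : table e i (e ⟨i, a⟩).1 ≤ 1 := by
      rcases h i (e ⟨i, a⟩).1 with h | h <;> omega
    rw [table, Matrix.of_apply, Finset.card_le_one] at h1
    rw [h1 a (by simp) a' (by simp [hc])]
  · intro h
    refine ⟨fun i j => ?_, sum_table_row e, sum_table_col e⟩
    have h1 : table e i j ≤ 1 := by
      rw [table, Matrix.of_apply, Finset.card_le_one]
      intro a ha b hb
      simp only [Finset.mem_filter, Finset.mem_univ, true_and] at ha hb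
      have := e.injective (h (e ⟨i, a⟩) (e ⟨i, b⟩) (ha.trans hb.symm) (by simp))
      simpa using this
    omega

open Classical in
theorem toReal_randomTable_binaryTables (h : ∑ i, r i = ∑ j, c j) :
    ((randomTable r c h).toOuterMeasure (binaryTables r c)).toReal =
      ((Finset.univ.filter fun e : Token r ≃ Token c => table e ∈ binaryTables r c).card : ℝ) /
        Fintype.card (Token r ≃ Token c) := by
  have := nonempty_matching h
  rw [randomTable, PMF.toOuterMeasure_map_apply, PMF.toOuterMeasure_uniformOfFintype_apply]
  rw [ENNReal.toReal_div, ENNReal.toReal_natCast, ENNReal.toReal_natCast, Fintype.card_subtype]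
  simp

/-- If some column has more than `k` tokens, the probability of a binary table is at most `k + 1`
times the proportion of tokens outside the first `k` rows. -/
theorem toReal_randomTable_binaryTables_le (h : ∑ i, r i = ∑ j, c j) {k : ℕ} {j : Fin n}
    (hk : k < c j) :
    ((randomTable r c h).toOuterMeasure (binaryTables r c)).toReal ≤
      (k + 1) * ((∑ i : Fin m with k ≤ i.1, r i : ℕ) : ℝ) / ((∑ i, r i : ℕ) : ℝ) := by
  classical
  have := nonempty_matching h
  set A : Finset (Token r) := Finset.univ.filter fun x => k ≤ x.1.1 with hA
  have hAc : A.card = ∑ i : Fin m with k ≤ i.1, r i :=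
    card_filter_token_fst (fun i : Fin m => k ≤ i.1)
  have hY : Fintype.card (Token c) = ∑ i, r i := by simp [Token, h]
  let y : Fin (k + 1) → Token c := fun a => ⟨j, ⟨a, by omega⟩⟩
  have hsub : (Finset.univ.filter fun e : Token r ≃ Token c => table e ∈ binaryTables r c) ⊆
      (Finset.univ : Finset (Fin (k + 1))).biUnion
        fun a => Finset.univ.filter fun e : Token r ≃ Token c => e.symm (y a) ∈ A := by
    intro e he
    simp only [Finset.mem_filter, Finset.mem_univ, true_and, table_mem_binaryTables_iff] at he
    simp only [Finset.mem_biUnion, Finset.mem_filter, Finset.mem_univ, true_and, hA]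
    -- Pigeonhole: `k + 1` tokens of one column cannot occupy distinct rows among the first `k`.
    by_contra! hlt
    have hinj : Function.Injective (fun a : Fin (k + 1) =>
        (⟨(e.symm (y a)).1.1, hlt a⟩ : Fin k)) := by
      intro a b hab
      have := he (y a) (y b) rfl (Fin.ext (by simpa using hab))
      simpa [y, Fin.ext_iff] using this
    simpa using Fintype.card_le_of_injective _ hinj
  have hle : (∑ i, r i) *
      (Finset.univ.filter fun e : Token r ≃ Token c => table e ∈ binaryTables r c).card ≤
      (k + 1) * (A.card * Fintype.card (Token r ≃ Token c)) := by
    calc _ ≤ (∑ i, r i) * ∑ a : Fin (k + 1),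
          (Finset.univ.filter fun e : Token r ≃ Token c => e.symm (y a) ∈ A).card := by
          gcongr
          exact (Finset.card_le_card hsub).trans Finset.card_biUnion_le
      _ = ∑ a : Fin (k + 1), Fintype.card (Token c) *
          (Finset.univ.filter fun e : Token r ≃ Token c => e.symm (y a) ∈ A).card := by
          rw [Finset.mul_sum, hY]
      _ ≤ ∑ _a : Fin (k + 1), A.card * Fintype.card (Token r ≃ Token c) :=
          Finset.sum_le_sum fun a _ => card_mul_card_matched_into_le A (y a)
      _ = _ := by simp
  have hpos : 0 < ∑ i, r i := by
    rw [h]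
    exact lt_of_lt_of_le (by omega) (Finset.single_le_sum (fun _ _ => Nat.zero_le _)
      (Finset.mem_univ j))
  rw [toReal_randomTable_binaryTables, ← hAc, div_le_div_iff₀ (by exact_mod_cast Fintype.card_pos)
    (by exact_mod_cast hpos)]
  calc _ = (((∑ i, r i) * (Finset.univ.filter
        fun e : Token r ≃ Token c => table e ∈ binaryTables r c).card : ℕ) : ℝ) := by
        push_cast; ring
    _ ≤ (((k + 1) * (A.card * Fintype.card (Token r ≃ Token c)) : ℕ) : ℝ) := by
        exact_mod_cast hle
    _ = _ := by push_cast; ring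

/-- The tokens of the columns with at least two tokens. -/
def multipleTokens (c : Fin n → ℕ) : Finset (Token c) :=
  Finset.univ.filter fun y => 2 ≤ c y.1

theorem card_multipleTokens_le : (multipleTokens c).card ≤ ∑ j, c j * (c j - 1) := by
  rw [multipleTokens, card_filter_token_fst (fun j => 2 ≤ c j), Finset.sum_filter]
  refine Finset.sum_le_sum fun j _ => ?_
  split_ifs with hj
  · exact Nat.le_mul_of_pos_right _ (by omega)
  · exact Nat.zero_le _

theorem mem_multipleTokens_of_ne {y y' : Token c} (h : y.1 = y'.1) (hne : y ≠ y') :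
    y ∈ multipleTokens c := by
  obtain ⟨j, a⟩ := y
  obtain ⟨j', b⟩ := y'
  simp only at h
  subst h
  simp only [multipleTokens, Finset.mem_filter, Finset.mem_univ, true_and]
  by_contra hlt
  exact hne (by simp [Fin.ext_iff]; omega)

/-- Tokens alone in their column never conflict, so only `multipleTokens c` has to be controlled. In
`hA`, the `1` absorbs the rounding of `θ * N` up to an integer and `C * s` the colours already used.
-/
theorem pow_le_toReal_randomTable_binaryTables (h : ∑ i, r i = ∑ j, c j) {β : Type*}
    [DecidableEq β] {A : Token c → Finset (Token r)} {g : Token r → β} {s C : ℕ} {θ : ℝ}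
    (hθ : 0 < θ) (hC : (multipleTokens c).card ≤ C) (hN : 0 < ∑ i, r i) (hθ1 : θ ≤ 1)
    (hs : ∀ w ∈ multipleTokens c, ∀ x ∈ A w,
      (Finset.univ.filter fun x' => g x = g x').card ≤ s)
    (hA : ∀ y ∈ multipleTokens c, θ * ((∑ i, r i : ℕ) : ℝ) + 1 + C * s ≤ (A y).card)
    (hgood : ∀ e ∈ colourfulMatchings (multipleTokens c) A g, table e ∈ binaryTables r c) :
    θ ^ C ≤ ((randomTable r c h).toOuterMeasure (binaryTables r c)).toReal := by
  classical
  have := nonempty_matching h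
  set N := ∑ i, r i with hNdef
  have hY : Fintype.card (Token c) = N := by simp [Token, h]
  set d := (multipleTokens c).card with hd
  set t := ⌈θ * N⌉₊ with ht
  have ht1 : (t : ℝ) < θ * N + 1 := Nat.ceil_lt_add_one (by positivity)
  have ht2 : θ * N ≤ t := Nat.le_ceil _
  have key := pow_mul_card_le_card_colourfulMatchings (t := t) hs fun y hy => by
    have h1 := hA y hy
    have h2 : (d : ℝ) * s ≤ C * s := by gcongr
    have h3 : (t : ℝ) + d * s ≤ (A y).card := by linarith
    exact_mod_cast h3
  rw [hY, ← hd] at key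
  have hsub : (colourfulMatchings (multipleTokens c) A g).card ≤
      (Finset.univ.filter fun e : Token r ≃ Token c => table e ∈ binaryTables r c).card :=
    Finset.card_le_card fun e he => Finset.mem_filter.2 ⟨Finset.mem_univ _, hgood e he⟩
  have hcard : (0 : ℝ) < Fintype.card (Token r ≃ Token c) := by exact_mod_cast Fintype.card_pos
  have hNpos : (0 : ℝ) < N := by exact_mod_cast hN
  rw [toReal_randomTable_binaryTables, le_div_iff₀ hcard]
  have key' : (t : ℝ) ^ d * Fintype.card (Token r ≃ Token c) ≤
      (N : ℝ) ^ d * (Finset.univ.filter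
        fun e : Token r ≃ Token c => table e ∈ binaryTables r c).card := by
    exact_mod_cast key.trans (Nat.mul_le_mul_left _ hsub)
  refine le_of_mul_le_mul_left ?_ (pow_pos hNpos d)
  calc (N : ℝ) ^ d * (θ ^ C * Fintype.card (Token r ≃ Token c))
      ≤ (N : ℝ) ^ d * (θ ^ d * Fintype.card (Token r ≃ Token c)) := by
        have := pow_le_pow_of_le_one hθ.le hθ1 hC
        gcongr
    _ = (θ * N) ^ d * Fintype.card (Token r ≃ Token c) := by ring
    _ ≤ (t : ℝ) ^ d * Fintype.card (Token r ≃ Token c) := by gcongr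
    _ ≤ _ := key'

/-- Lower bound when the rows from number `k` on are short but contain many tokens. -/
theorem pow_le_toReal_of_tail (h : ∑ i, r i = ∑ j, c j) {k s C : ℕ} {θ : ℝ}
    (hθ : 0 < θ) (hθ1 : θ ≤ 1) (hC : (multipleTokens c).card ≤ C) (hN : 0 < ∑ i, r i)
    (hs : ∀ i : Fin m, k ≤ i.1 → r i ≤ s)
    (htail : θ * ((∑ i, r i : ℕ) : ℝ) + 1 + C * s ≤ (∑ i : Fin m with k ≤ i.1, r i : ℕ)) :
    θ ^ C ≤ ((randomTable r c h).toOuterMeasure (binaryTables r c)).toReal := by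
  -- The colour of a token is its row, so a colourful matching uses distinct rows.
  refine pow_le_toReal_randomTable_binaryTables h
    (A := fun _ => Finset.univ.filter fun x => k ≤ x.1.1) (g := Sigma.fst) hθ hC hN hθ1
    ?_ ?_ ?_ (s := s)
  · intro w _ x hx
    simp only [Finset.mem_filter, Finset.mem_univ, true_and] at hx
    rw [card_filter_token_fst (fun i => x.1 = i)]
    simpa [Finset.sum_filter] using hs x.1 hx
  · intro y _
    rwa [card_filter_token_fst (fun i : Fin m => k ≤ i.1)]
  · intro e he
    rw [table_mem_binaryTables_iff]
    intro y y' hc hr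
    by_contra hne
    exact hne ((mem_colourfulMatchings.1 he y (mem_multipleTokens_of_ne hc hne)).2 y'
      (mem_multipleTokens_of_ne hc.symm (Ne.symm hne)) hr)

/-- Lower bound when there are as many long rows as tokens in the largest column. -/
theorem pow_le_toReal_of_long_rows (h : ∑ i, r i = ∑ j, c j) {q C : ℕ} {θ : ℝ}
    (hθ : 0 < θ) (hθ1 : θ ≤ 1) (hC : (multipleTokens c).card ≤ C) (hN : 0 < ∑ i, r i)
    (hc : ∀ j, c j ≤ q)
    (hrows : ∀ a < q, ∃ i : Fin m, i.1 = a ∧ θ * ((∑ i, r i : ℕ) : ℝ) + 1 + C ≤ r i) :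
    θ ^ C ≤ ((randomTable r c h).toOuterMeasure (binaryTables r c)).toReal := by
  classical
  -- Tokens of one column have distinct target rows, so the colouring `id` adds no constraint; `s =
  -- 1` accounts for tokens already taken.
  refine pow_le_toReal_randomTable_binaryTables h
    (A := fun y => Finset.univ.filter fun x => x.1.1 = y.2.1) (g := id) hθ hC hN hθ1
    ?_ ?_ ?_ (s := 1)
  · intro w _ x _
    simp [Finset.filter_eq]
  · intro y _
    obtain ⟨i, hi, hle⟩ := hrows y.2.1 (y.2.2.trans_le (hc _))
    rw [card_filter_token_fst (fun i : Fin m => i.1 = y.2.1), ← hi]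
    simpa [← Fin.ext_iff, Finset.sum_filter] using hle
  · intro e he
    rw [table_mem_binaryTables_iff]
    intro y y' hc hr
    by_contra hne
    have h1 := (mem_colourfulMatchings.1 he y (mem_multipleTokens_of_ne hc hne)).1
    have h2 := (mem_colourfulMatchings.1 he y' (mem_multipleTokens_of_ne hc.symm (Ne.symm hne))).1
    simp only [Finset.mem_filter, Finset.mem_univ, true_and] at h1 h2
    rw [hr, h2] at h1
    obtain ⟨j, a⟩ := y
    obtain ⟨j', b⟩ := y'
    simp only at hc
    subst hc
    exact hne (by simpa [Fin.ext_iff] using h1.symm)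

end Table

end ConfigModel

/-! ### Asymptotics along the sequence -/

namespace ConfigModel.InputSequence

variable {S : InputSequence}

theorem probBinary_nonneg (S : InputSequence) (ℓ : ℕ) : 0 ≤ S.probBinary ℓ :=
  ENNReal.toReal_nonneg

theorem tailSum_eq {k : ℕ} (hk : S.kappa = ((k + 1 : ℕ) : ℕ∞)) (ℓ : ℕ) :
    S.tailSum ℓ = ∑ i : Fin (S.m ℓ) with k ≤ i.1, S.r ℓ i := by
  rw [tailSum, hk, Finset.sum_filter, Finset.sum_filter, Finset.sum_range]
  refine Finset.sum_congr rfl fun i _ => ?_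
  simp only [Nat.cast_le, Nat.add_le_add_iff_right]

theorem tailSum_eq_zero (hk : S.kappa = ⊤) (ℓ : ℕ) : S.tailSum ℓ = 0 := by
  rw [tailSum, hk, Finset.sum_filter]
  refine Finset.sum_eq_zero fun i _ => if_neg ?_
  rw [top_le_iff]
  exact ENat.natCast_ne_top _

theorem exists_kappa_eq (hk : S.kappa ≠ ⊤) : ∃ k : ℕ, S.kappa = ((k + 1 : ℕ) : ℕ∞) ∧
    (fun ℓ => (S.r ℓ k : ℝ)) =o[atTop] (fun ℓ => (S.N ℓ : ℝ)) := by
  refine csInf_mem (s := {k : ℕ∞ | ∃ i : ℕ, k = ((i + 1 : ℕ) : ℕ∞) ∧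
    (fun ℓ => (S.r ℓ i : ℝ)) =o[atTop] (fun ℓ => (S.N ℓ : ℝ))}) ?_
  by_contra h
  exact hk (by rw [kappa, Set.not_nonempty_iff_eq_empty.1 h, sInf_empty])

theorem not_isLittleO_of_lt_kappa {i : ℕ} (hi : ((i + 1 : ℕ) : ℕ∞) < S.kappa) :
    ¬ (fun ℓ => (S.r ℓ i : ℝ)) =o[atTop] (fun ℓ => (S.N ℓ : ℝ)) :=
  fun h => (show S.kappa ≤ _ from sInf_le ⟨i, rfl, h⟩).not_gt hi

theorem c_zero_le {ℓ C : ℕ} (h : ∑ j : Fin (S.n ℓ), S.c ℓ j * (S.c ℓ j - 1) ≤ C) :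
    S.c ℓ 0 ≤ C + 1 := by
  rcases Nat.eq_zero_or_pos (S.n ℓ) with hn | hn
  · rw [S.c_eq_zero ℓ 0 hn.le]
    exact Nat.zero_le _
  · have h1 := Finset.single_le_sum (f := fun j : Fin (S.n ℓ) => S.c ℓ j * (S.c ℓ j - 1))
      (fun _ _ => Nat.zero_le _) (Finset.mem_univ ⟨0, hn⟩)
    have h2 : S.c ℓ 0 * (S.c ℓ 0 - 1) ≤ C := h1.trans h
    by_contra! hlt
    have : (C + 2) * (C + 1) ≤ S.c ℓ 0 * (S.c ℓ 0 - 1) := Nat.mul_le_mul (by omega) (by omega)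
    nlinarith

theorem eventually_le_mul_N (hN : Tendsto S.N atTop atTop) (a : ℝ) {δ : ℝ} (hδ : 0 < δ) :
    ∀ᶠ ℓ in atTop, a ≤ δ * S.N ℓ :=
  ((tendsto_natCast_atTop_atTop.comp hN).const_mul_atTop hδ).eventually_ge_atTop a

/-- If the limsup condition fails, the probability of a binary table is not bounded below. -/
theorem frequently_probBinary_lt (hN : Tendsto S.N atTop atTop) {C : ℕ}
    (hC : ∀ᶠ ℓ in atTop, ∑ j : Fin (S.n ℓ), S.c ℓ j * (S.c ℓ j - 1) ≤ C)
    (htail : limsup (fun ℓ => (S.tailSum ℓ : ℝ≥0∞) / (S.N ℓ : ℝ≥0∞)) atTop = 0)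
    (hc : S.kappa ≤ limsup (fun ℓ => (S.c ℓ 0 : ℕ∞)) atTop) {ε : ℝ} (hε : 0 < ε) :
    ∃ᶠ ℓ in atTop, S.probBinary ℓ < ε := by
  have hbdd : limsup (fun ℓ => (S.c ℓ 0 : ℕ∞)) atTop ≤ ((C + 1 : ℕ) : ℕ∞) :=
    limsup_le_of_le (by isBoundedDefault)
      (hC.mono fun ℓ h => by exact_mod_cast c_zero_le h)
  -- Bounded column sums make `κ` finite.
  have hk : S.kappa ≠ ⊤ := fun h => by
    rw [h] at hc
    exact ENat.natCast_ne_top _ (top_le_iff.1 (hc.trans hbdd))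
  obtain ⟨k, hk, -⟩ := exists_kappa_eq hk
  have hfreq : ∃ᶠ ℓ in atTop, (k : ℕ∞) < S.c ℓ 0 := by
    refine frequently_lt_of_lt_limsup (by isBoundedDefault) (lt_of_lt_of_le ?_ hc)
    rw [hk]
    exact_mod_cast Nat.lt_succ_self k
  have hδ : 0 < ε / (k + 2) := by positivity
  have hev : ∀ᶠ ℓ in atTop, (S.tailSum ℓ : ℝ≥0∞) / (S.N ℓ : ℝ≥0∞) <
      ENNReal.ofReal (ε / (k + 2)) :=
    eventually_lt_of_limsup_lt (by rw [htail]; exact ENNReal.ofReal_pos.2 hδ)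
  refine (hfreq.and_eventually (hev.and (hN.eventually_gt_atTop 0))).mono ?_
  rintro ℓ ⟨h1, h2, h3⟩
  have h1 : k < S.c ℓ 0 := by exact_mod_cast h1
  have hn : 0 < S.n ℓ := by
    by_contra! h
    rw [S.c_eq_zero ℓ 0 h] at h1
    omega
  have hNpos : (0 : ℝ) < S.N ℓ := by exact_mod_cast h3
  have hle := toReal_randomTable_binaryTables_le (r := fun i : Fin (S.m ℓ) => S.r ℓ i)
    (c := fun j : Fin (S.n ℓ) => S.c ℓ j) ((S.sum_r ℓ).trans (S.sum_c ℓ).symm)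
    (j := ⟨0, hn⟩) h1
  refine lt_of_le_of_lt hle ?_
  rw [← tailSum_eq hk, S.sum_r]
  rw [ENNReal.lt_ofReal_iff_toReal_lt (ne_top_of_lt h2), ENNReal.toReal_div,
    ENNReal.toReal_natCast, ENNReal.toReal_natCast, lt_div_iff₀ (by positivity)] at h2
  have h4 : (S.tailSum ℓ : ℝ) / S.N ℓ * (k + 1) ≤ (S.tailSum ℓ : ℝ) / S.N ℓ * (k + 2) := by
    gcongr
    norm_num
  calc _ = (S.tailSum ℓ : ℝ) / S.N ℓ * (k + 1) := by ring
    _ < ε := by linarith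

theorem frequently_le_probBinary_of_tail (hN : Tendsto S.N atTop atTop) {C : ℕ}
    (hC : ∀ᶠ ℓ in atTop, ∑ j : Fin (S.n ℓ), S.c ℓ j * (S.c ℓ j - 1) ≤ C)
    (htail : 0 < limsup (fun ℓ => (S.tailSum ℓ : ℝ≥0∞) / (S.N ℓ : ℝ≥0∞)) atTop) :
    ∃ ε > 0, ∃ᶠ ℓ in atTop, ε ≤ S.probBinary ℓ := by
  have hk : S.kappa ≠ ⊤ := fun h => by simp [tailSum_eq_zero h] at htail
  obtain ⟨k, hk, ho⟩ := exists_kappa_eq hk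
  obtain ⟨δ, hδ0, hδ⟩ := ENNReal.lt_iff_exists_nnreal_btwn.1 htail
  have hδ0 : (0 : ℝ) < δ := by exact_mod_cast hδ0
  have hfreq := frequently_lt_of_lt_limsup (by isBoundedDefault) hδ
  -- The tail exceeds `4 * θ * N`, while the target, the rounding and the loss `C * r_κ = o(N)` each
  -- need at most `θ * N`.
  set θ : ℝ := min (δ : ℝ) 1 / 4 with hθ
  have hθ0 : 0 < θ := by positivity
  have hθ1 : θ ≤ 1 := by linarith [min_le_right (δ : ℝ) 1]
  have hθδ : 4 * θ ≤ δ := by linarith [min_le_left (δ : ℝ) 1]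
  refine ⟨θ ^ C, by positivity, ?_⟩
  refine (hfreq.and_eventually (hC.and ((hN.eventually_gt_atTop 0).and
    ((eventually_le_mul_N hN 1 hθ0).and
      (isLittleO_iff.1 ho (show 0 < θ / (C + 1) by positivity)))))).mono ?_
  rintro ℓ ⟨h1, h2, h3, h4, h5⟩
  have hNpos : (0 : ℝ) < S.N ℓ := by exact_mod_cast h3
  have h1 : (δ : ℝ) * S.N ℓ < S.tailSum ℓ := by
    rw [ENNReal.lt_div_iff_mul_lt (Or.inl (by exact_mod_cast h3.ne')) (Or.inl (by simp))] at h1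
    exact_mod_cast h1
  simp only [Real.norm_natCast] at h5
  refine pow_le_toReal_of_tail (r := fun i : Fin (S.m ℓ) => S.r ℓ i)
    (c := fun j : Fin (S.n ℓ) => S.c ℓ j) (s := S.r ℓ k) (k := k) _ hθ0 hθ1
    (card_multipleTokens_le.trans h2) (by rwa [S.sum_r])
    (fun i hi => S.r_antitone ℓ hi) ?_
  rw [← tailSum_eq hk, S.sum_r]
  have h6 : (C : ℝ) * S.r ℓ k ≤ θ * S.N ℓ := by
    calc (C : ℝ) * S.r ℓ k ≤ (C + 1) * (θ / (C + 1) * S.N ℓ) := by gcongr; linarith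
      _ = θ * S.N ℓ := by field_simp
  have h7 : 4 * θ * S.N ℓ ≤ δ * S.N ℓ := by gcongr
  have h8 : 0 < θ * S.N ℓ := by positivity
  linarith

theorem frequently_le_probBinary_of_lt_kappa (hN : Tendsto S.N atTop atTop) {C : ℕ}
    (hC : ∀ᶠ ℓ in atTop, ∑ j : Fin (S.n ℓ), S.c ℓ j * (S.c ℓ j - 1) ≤ C)
    (hc : limsup (fun ℓ => (S.c ℓ 0 : ℕ∞)) atTop < S.kappa) :
    ∃ ε > 0, ∃ᶠ ℓ in atTop, ε ≤ S.probBinary ℓ := by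
  obtain ⟨q, hq⟩ := ENat.ne_top_iff_exists.1 (ne_top_of_lt hc)
  have hcq : ∀ᶠ ℓ in atTop, S.c ℓ 0 ≤ q := by
    have h : limsup (fun ℓ => (S.c ℓ 0 : ℕ∞)) atTop < ((q + 1 : ℕ) : ℕ∞) := by
      rw [← hq]
      exact_mod_cast Nat.lt_succ_self q
    refine (eventually_lt_of_limsup_lt h).mono fun ℓ h => ?_
    exact Nat.lt_succ_iff.1 (by exact_mod_cast h)
  -- As `N → ∞`, columns cannot all be empty, so there is a row of index `q - 1`; as `q < κ`, it is
  -- not `o(N)`, and the rows above it are at least as long.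
  have hq0 : q ≠ 0 := by
    rintro rfl
    obtain ⟨ℓ, h1, h2⟩ := (hcq.and (hN.eventually_gt_atTop 0)).exists
    rw [← S.sum_c, Finset.sum_eq_zero] at h2
    · exact lt_irrefl _ h2
    · intro j _
      exact Nat.le_zero.1 ((S.c_antitone ℓ (Nat.zero_le j.1)).trans h1)
  obtain ⟨i, rfl⟩ := Nat.exists_eq_succ_of_ne_zero hq0
  rw [← hq] at hc
  have ho := not_isLittleO_of_lt_kappa hc
  rw [isLittleO_iff] at ho
  push Not at ho
  obtain ⟨δ, hδ0, hfreq⟩ := ho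
  set θ : ℝ := min δ 1 / 2 with hθ
  have hθ0 : 0 < θ := by positivity
  have hθ1 : θ ≤ 1 := by linarith [min_le_right (δ : ℝ) 1]
  have hθδ : 2 * θ ≤ δ := by linarith [min_le_left (δ : ℝ) 1]
  refine ⟨θ ^ C, by positivity, ?_⟩
  refine (hfreq.and_eventually (hC.and ((hN.eventually_gt_atTop 0).and
    ((eventually_le_mul_N hN (1 + C) hθ0).and hcq)))).mono ?_
  rintro ℓ ⟨h1, h2, h3, h4, h5⟩
  have hNpos : (0 : ℝ) < S.N ℓ := by exact_mod_cast h3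
  simp only [Real.norm_natCast] at h1
  refine pow_le_toReal_of_long_rows (r := fun i : Fin (S.m ℓ) => S.r ℓ i)
    (c := fun j : Fin (S.n ℓ) => S.c ℓ j) (q := i + 1) _ hθ0 hθ1
    (card_multipleTokens_le.trans h2) (by rwa [S.sum_r])
    (fun j => (S.c_antitone ℓ (Nat.zero_le _)).trans h5) ?_
  intro a ha
  have hai : (S.r ℓ i : ℝ) ≤ S.r ℓ a := by exact_mod_cast S.r_antitone ℓ (Nat.lt_succ_iff.1 ha)
  have hpos : 0 < δ * S.N ℓ := by positivity
  have ham : a < S.m ℓ := by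
    by_contra! h
    rw [S.r_eq_zero ℓ a h] at hai
    push_cast at hai
    linarith
  refine ⟨⟨a, ham⟩, rfl, ?_⟩
  rw [S.sum_r]
  have h7 : 2 * θ * S.N ℓ ≤ δ * S.N ℓ := by gcongr
  simp only
  linarith

/-- If the largest row has order `N`, the second moment condition bounds the columns alone. -/
theorem exists_eventually_sum_c_le (hN : Tendsto S.N atTop atTop)
    (hsum : (fun ℓ => ∑ i ∈ Finset.range (S.m ℓ), ∑ j ∈ Finset.range (S.n ℓ),
        (S.r ℓ i : ℝ) * ((S.r ℓ i : ℝ) - 1) * (S.c ℓ j : ℝ) * ((S.c ℓ j : ℝ) - 1))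
      =O[atTop] (fun ℓ => (S.N ℓ : ℝ) ^ 2))
    (hr : (fun ℓ => (S.N ℓ : ℝ)) =O[atTop] (fun ℓ => (S.r ℓ 0 : ℝ))) :
    ∃ C : ℕ, ∀ᶠ ℓ in atTop, ∑ j : Fin (S.n ℓ), S.c ℓ j * (S.c ℓ j - 1) ≤ C := by
  obtain ⟨K, hK0, hK⟩ := hsum.exists_pos
  obtain ⟨a, ha0, ha⟩ := hr.exists_pos
  rw [IsBigOWith] at hK ha
  -- From `r_1 ≥ 2` comes `r_1 ^ 2 ≤ 2 * r_1 * (r_1 - 1)`; inserting `N ≤ a * r_1` and cancelling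
  -- `r_1 ^ 2` gives this bound.
  refine ⟨⌈2 * K * a ^ 2⌉₊, ?_⟩
  filter_upwards [hK, ha, hN.eventually_gt_atTop 0,
    eventually_le_mul_N hN 2 (inv_pos.2 ha0)] with ℓ h1 h2 h3 h4
  simp only [Real.norm_natCast] at h2
  have hNpos : (0 : ℝ) < S.N ℓ := by exact_mod_cast h3
  have hr2 : (2 : ℝ) ≤ S.r ℓ 0 := by
    refine h4.trans ?_
    rwa [inv_mul_le_iff₀ ha0]
  have hm : 0 < S.m ℓ := by
    by_contra! h
    rw [S.r_eq_zero ℓ 0 h] at hr2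
    norm_num at hr2
  -- Truncated subtraction is harmless: at `x = 0` both products vanish.
  have hnat : ∀ x : ℕ, (0 : ℝ) ≤ (x : ℝ) * ((x : ℝ) - 1) ∧
      ((x * (x - 1) : ℕ) : ℝ) = (x : ℝ) * ((x : ℝ) - 1) := by
    intro x
    rcases x with _ | x
    · simp
    · push_cast
      simp only [add_sub_cancel_right, and_true]
      positivity
  set V : ℝ := ∑ j ∈ Finset.range (S.n ℓ), (S.c ℓ j : ℝ) * ((S.c ℓ j : ℝ) - 1) with hV
  have hV0 : 0 ≤ V := Finset.sum_nonneg fun j _ => (hnat _).1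
  have hprod : ∑ i ∈ Finset.range (S.m ℓ), ∑ j ∈ Finset.range (S.n ℓ),
      (S.r ℓ i : ℝ) * ((S.r ℓ i : ℝ) - 1) * (S.c ℓ j : ℝ) * ((S.c ℓ j : ℝ) - 1) =
      ∑ i ∈ Finset.range (S.m ℓ), (S.r ℓ i : ℝ) * ((S.r ℓ i : ℝ) - 1) * V := by
    refine Finset.sum_congr rfl fun i _ => ?_
    rw [hV, Finset.mul_sum]
    exact Finset.sum_congr rfl fun j _ => by ring
  have h5 : (S.r ℓ 0 : ℝ) * ((S.r ℓ 0 : ℝ) - 1) * V ≤ K * (S.N ℓ : ℝ) ^ 2 := by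
    have h6 := Finset.single_le_sum
      (f := fun i => (S.r ℓ i : ℝ) * ((S.r ℓ i : ℝ) - 1) * V)
      (fun i _ => mul_nonneg (hnat _).1 hV0) (Finset.mem_range.2 hm)
    refine h6.trans ?_
    rw [← hprod]
    refine (le_abs_self _).trans (h1.trans_eq ?_)
    rw [Real.norm_of_nonneg (by positivity)]
  have h6 : (S.r ℓ 0 : ℝ) ^ 2 * V ≤ (S.r ℓ 0 : ℝ) ^ 2 * (2 * K * a ^ 2) := by
    calc (S.r ℓ 0 : ℝ) ^ 2 * V ≤ 2 * ((S.r ℓ 0 : ℝ) * ((S.r ℓ 0 : ℝ) - 1)) * V := by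
          gcongr
          nlinarith
      _ ≤ 2 * (K * (S.N ℓ : ℝ) ^ 2) := by linarith
      _ ≤ 2 * (K * (a * S.r ℓ 0) ^ 2) := by gcongr
      _ = _ := by ring
  have h7 : V ≤ 2 * K * a ^ 2 := le_of_mul_le_mul_left h6 (by positivity)
  have h8 : ((∑ j : Fin (S.n ℓ), S.c ℓ j * (S.c ℓ j - 1) : ℕ) : ℝ) = V := by
    rw [hV, Finset.sum_range, Nat.cast_sum]
    exact Finset.sum_congr rfl fun j _ => (hnat _).2
  exact_mod_cast (h8.le.trans h7).trans (Nat.le_ceil _)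

end ConfigModel.InputSequence

theorem proposition3 (S : ConfigModel.InputSequence)
    (hN : Tendsto S.N atTop atTop)
    (hsum : (fun ℓ => ∑ i ∈ Finset.range (S.m ℓ), ∑ j ∈ Finset.range (S.n ℓ),
        (S.r ℓ i : ℝ) * ((S.r ℓ i : ℝ) - 1) * (S.c ℓ j : ℝ) * ((S.c ℓ j : ℝ) - 1))
      =O[atTop] (fun ℓ => (S.N ℓ : ℝ) ^ 2))
    (hr : (fun ℓ => (S.N ℓ : ℝ)) =O[atTop] (fun ℓ => (S.r ℓ 0 : ℝ))) :
    ((fun _ : ℕ => (1 : ℝ)) =O[atTop] (fun ℓ => S.probBinary ℓ)) ↔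
      ∀ S' : ConfigModel.InputSequence, S'.IsSubseq S →
        0 < limsup (fun ℓ => (S'.tailSum ℓ : ℝ≥0∞) / (S'.N ℓ : ℝ≥0∞)) atTop ∨
        limsup (fun ℓ => (S'.c ℓ 0 : ℕ∞)) atTop < S'.kappa := by
  obtain ⟨C, hC⟩ := ConfigModel.InputSequence.exists_eventually_sum_c_le hN hsum hr
  constructor
  · rintro hO _ ⟨k, hk, rfl⟩
    by_contra! hcon
    obtain ⟨K, hK0, hK⟩ := hO.exists_pos
    rw [IsBigOWith] at hK
    have hlt := ConfigModel.InputSequence.frequently_probBinary_lt (S := S.subseq k)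
      (hN.comp hk.tendsto_atTop) (hk.tendsto_atTop.eventually hC)
      (nonpos_iff_eq_zero.1 hcon.1) hcon.2 (inv_pos.2 hK0)
    obtain ⟨ℓ, h1, h2⟩ := (hlt.and_eventually (hk.tendsto_atTop.eventually hK)).exists
    rw [norm_one, Real.norm_of_nonneg (S.probBinary_nonneg _)] at h2
    have h3 : S.probBinary (k ℓ) < K⁻¹ := h1
    have h4 := mul_lt_mul_of_pos_left h3 hK0
    rw [mul_inv_cancel₀ hK0.ne'] at h4
    exact h4.not_ge h2
  · intro hcond
    by_contra hO
    -- Without a uniform lower bound, some subsequence has probabilities tending to `0`; the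
    -- condition for that subsequence gives a fixed `ε` infinitely often, a contradiction.
    have hfreq : ∀ n : ℕ, ∃ᶠ ℓ in atTop, S.probBinary ℓ < 1 / ((n : ℝ) + 1) := by
      intro n hn
      refine hO (IsBigO.of_bound ((n : ℝ) + 1) (hn.mono fun ℓ h => ?_))
      rw [norm_one, Real.norm_of_nonneg (S.probBinary_nonneg _)]
      rw [not_lt, div_le_iff₀ (by positivity)] at h
      linarith
    obtain ⟨k, hk, hlt⟩ := extraction_forall_of_frequently hfreq
    have hN' := hN.comp hk.tendsto_atTop
    have hC' := hk.tendsto_atTop.eventually hC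
    obtain ⟨ε, hε, hle⟩ : ∃ ε > 0, ∃ᶠ ℓ in atTop, ε ≤ (S.subseq k).probBinary ℓ := by
      rcases hcond (S.subseq k) ⟨k, hk, rfl⟩ with h | h
      · exact ConfigModel.InputSequence.frequently_le_probBinary_of_tail hN' hC' h
      · exact ConfigModel.InputSequence.frequently_le_probBinary_of_lt_kappa hN' hC' h
    have hsmall := tendsto_one_div_add_atTop_nhds_zero_nat.eventually_lt_const hε
    obtain ⟨ℓ, h1, h2⟩ := (hle.and_eventually hsmall).exists
    exact lt_irrefl _ ((h1.trans_lt (hlt ℓ)).trans h2)
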